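/- Let $G=(V,E)$ be a finite simple graph with minimum degree $\delta(G)$. We say that $G$ has the MMS property if for every $f:V\to\mathbb{R}$ with $\sum_{v\in V}f(v)\ge 0$ there are at least $\delta(G)$ edges $uv\in E$ with $f(u)+f(v)\ge 0$. For $n\in\mathbb{N}$ and $q\in[0,1]$ let $\mathbf{G}(n,q)$ be the random graph on $n$ labelled vertices in which each pair of distinct vertices forms an edge independently with probability $q$. Theorem. Let $\varepsilon>0$ and let $p=p(n)\in[0,1]$ be a sequence such that either $p=\omega\!\left(\frac{\log n}{n}\right)$ as $n\to\infty$, or $p(n)<\frac{(1-\varepsilon)\log n}{n}$ for all sufficiently large $n$. Then $\mathbf{G}(n,p)$ has the MMS property with high probability, that is, $$\lim_{n\to\infty}\mathbb{P}\bigl(\mathbf{G}(n,p(n))\text{ has the MMS property}\bigr)=1.$$ -/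

import Mathlib

open Filter Topology Asymptotics

open scoped Classical in
/-- The Manickam-Miklós-Singhi property of a finite graph: every real weighting of the vertices with
nonnegative total weight has at least `δ(G)` nonnegative edges, an edge being nonnegative when the
sum of the weights of its vertices is nonnegative. -/
def SimpleGraph.HasMMSProperty {V : Type*} [Fintype V] (G : SimpleGraph V) : Prop :=
  ∀ f : V → ℝ, 0 ≤ ∑ v, f v →
    G.minDegree ≤ (G.edgeFinset.filter (fun e => 0 ≤ ∑ v ∈ e.toFinset, f v)).card

/-! A weighting with nonnegative sum has a level l ≥ 0 for which S = {f ≥ l} is larger than T = {f <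
-l} (`exists_level_card_lt`), and every edge meeting S and avoiding T is nonnegative. So it suffices
that each `pairSet S T` with |T| < |S| contains δ(G) edges. If |S| = 1, its edges number a vertex
degree. If |S| ≥ 2, it has at least 2n - 36 pairs, so roughly 2np or more expected edges, while δ(G)
is at most the degree of one fixed vertex, about np. The threshold 5/4·np separates the two, and for
np ≥ 500 log n the Chernoff bounds survive a union over all (S, T). In the sparse range a second
moment argument yields an isolated vertex, so δ(G) = 0 and nothing is required. -/

namespace SimpleGraph

open MeasureTheory Finset

/-! ### Counting pairs that meet S and avoid T. -/

section PairSet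

variable {V : Type*} [Fintype V] [DecidableEq V]

/-- The pairs of distinct vertices that meet `S` and avoid `T`. -/
def pairSet (S T : Finset V) : Finset (Sym2 V) :=
  (Tᶜ.offDiag.image Sym2.mk.uncurry) \ ((S ∪ T)ᶜ.offDiag.image Sym2.mk.uncurry)

theorem mk_mem_pairSet {S T : Finset V} {u v : V} :
    s(u, v) ∈ pairSet S T ↔ u ≠ v ∧ u ∉ T ∧ v ∉ T ∧ (u ∈ S ∨ v ∈ S) := by
  have key : ∀ R : Finset V, s(u, v) ∈ R.offDiag.image Sym2.mk.uncurry ↔ u ∈ R ∧ v ∈ R ∧ u ≠ v := by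
    intro R
    simp only [mem_image, mem_offDiag, Prod.exists, Function.uncurry_apply_pair, Sym2.eq_iff]
    grind
  rw [pairSet, Finset.mem_sdiff, key, key]
  simp only [Finset.mem_compl, Finset.mem_union]
  grind

theorem not_isDiag_of_mem_pairSet {S T : Finset V} {e : Sym2 V} (he : e ∈ pairSet S T) :
    ¬ e.IsDiag := by
  induction e with
  | h u v => simpa using (mk_mem_pairSet.1 he).1

theorem card_pairSet (S T : Finset V) (h : Disjoint S T) :
    ((pairSet S T).card : ℝ) =
      S.card * (2 * (Fintype.card V - T.card) - S.card - 1) / 2 := by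
  have hsub : (S ∪ T)ᶜ.offDiag.image Sym2.mk.uncurry ⊆ Tᶜ.offDiag.image Sym2.mk.uncurry := by
    apply image_subset_image
    apply offDiag_mono
    exact compl_subset_compl.2 subset_union_right
  rw [pairSet, cast_card_sdiff hsub, Sym2.card_image_offDiag, Sym2.card_image_offDiag,
    Nat.cast_choose_two, Nat.cast_choose_two, card_compl, card_compl,
    Nat.cast_sub (card_le_univ _), Nat.cast_sub (card_le_univ _), card_union_of_disjoint h]
  push_cast
  ring

end PairSet

/-! ### Deterministic reduction from weightings to set pairs. -/

section Weighting

variable {V : Type*} [Fintype V]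

/-- A weighting with nonnegative sum has a level `l ≥ 0` such that more vertices have weight
at least `l` than have weight less than `-l`. -/
theorem exists_level_card_lt [Nonempty V] (f : V → ℝ) (hf : 0 ≤ ∑ v, f v) :
    ∃ l : ℝ, 0 ≤ l ∧
      (univ.filter fun v => f v < -l).card < (univ.filter fun v => l ≤ f v).card := by
  classical
  by_contra! hcon
  let t : {v // 0 ≤ f v} → Finset V := fun a => univ.filter fun b => f b < - f a
  -- Hall's condition for X is the negated claim at the level of its least weight. The matching
  -- pairs each nonnegative weight with a distinct one below its negative, forcing a negative total.
  obtain ⟨φ, hφ, hφt⟩ := (Finset.all_card_le_biUnion_card_iff_exists_injective t).1 (by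
    intro X
    rcases X.eq_empty_or_nonempty with rfl | hX
    · simp
    obtain ⟨x, hx, hmin⟩ := X.exists_min_image (fun a => f a) hX
    calc X.card = (X.map (Function.Embedding.subtype _)).card := (card_map _).symm
      _ ≤ (univ.filter fun v => f x ≤ f v).card := by
          apply card_le_card
          intro y hy
          obtain ⟨a, ha, rfl⟩ := mem_map.1 hy
          simpa using hmin a ha
      _ ≤ (univ.filter fun v => f v < - f x).card := hcon _ x.2
      _ ≤ _ := card_le_card (subset_biUnion_of_mem t hx))
  have hφ' : ∀ a, f (φ a) < - f a := fun a => by simpa [t] using hφt a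
  have hneg : ∀ a, f (φ a) < 0 := fun a => by have := hφ' a; have := a.2; linarith
  have hsplit := Finset.sum_filter_add_sum_filter_not univ (fun v => 0 ≤ f v) f
  have hA : ∑ v with 0 ≤ f v, f v = ∑ a : {v // 0 ≤ f v}, f a := by
    rw [← Finset.sum_subtype_eq_sum_filter]; simp
  have hB : ∑ v with ¬ 0 ≤ f v, f v ≤ ∑ a, f (φ a) := by
    rw [← Finset.sum_image (f := f) (g := φ) (s := univ) (fun _ _ _ _ h => hφ h)]
    refine neg_le_neg_iff.1 ?_
    rw [← Finset.sum_neg_distrib, ← Finset.sum_neg_distrib]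
    apply Finset.sum_le_sum_of_subset_of_nonneg
    · intro y hy
      obtain ⟨a, -, rfl⟩ := mem_image.1 hy
      simpa using hneg a
    · intro i hi _
      simp at hi
      linarith
  by_cases hne : Nonempty {v // 0 ≤ f v}
  · have : ∑ a : {v // 0 ≤ f v}, f (φ a) < ∑ a : {v // 0 ≤ f v}, - f a :=
      Finset.sum_lt_sum_of_nonempty univ_nonempty fun a _ => hφ' a
    rw [Finset.sum_neg_distrib] at this
    linarith
  · have : ∑ v, f v < ∑ v : V, (0 : ℝ) := by
      apply Finset.sum_lt_sum_of_nonempty univ_nonempty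
      intro v _
      by_contra! h
      exact hne ⟨⟨v, h⟩⟩
    simp at this
    linarith

open scoped Classical in
theorem hasMMSProperty_of_card_pairSet [Nonempty V] (G : SimpleGraph V)
    (h : ∀ S T : Finset V, Disjoint S T → T.card < S.card →
      G.minDegree ≤ (G.edgeFinset ∩ pairSet S T).card) : G.HasMMSProperty := by
  intro f hf
  obtain ⟨l, hl, hlt⟩ := exists_level_card_lt f hf
  refine (h _ _ ?_ hlt).trans (card_le_card ?_)
  · rw [disjoint_filter]
    intro v _ h1 h2
    linarith
  · intro e he
    induction e with
    | h u v =>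
      rw [mem_inter, mk_mem_pairSet] at he
      obtain ⟨hE, hne, h1, h2, h3⟩ := he
      refine mem_filter.2 ⟨hE, ?_⟩
      have : (s(u, v)).toFinset = {u, v} := by ext; simp
      rw [this, sum_pair hne]
      simp only [mem_filter, mem_univ, true_and, not_lt] at h1 h2 h3
      rcases h3 with h3 | h3 <;> linarith

open scoped Classical in
theorem card_edgeFinset_inter_pairSet_singleton (G : SimpleGraph V) (v : V) :
    (G.edgeFinset ∩ pairSet {v} ∅).card = G.degree v := by
  rw [← G.card_incidenceFinset_eq_degree]
  congr 1
  ext e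
  induction e with
  | h a b =>
    rw [mem_inter, mk_mem_pairSet, mem_incidenceFinset, mem_edgeFinset, mem_edgeSet,
      mk'_mem_incidenceSet_iff]
    have := fun h : G.Adj a b => h.ne
    simp only [mem_singleton, notMem_empty]
    grind

end Weighting

/-! ### Generating function and tail bounds. -/

section Random

variable {V : Type*} [Fintype V] (p : unitInterval)

instance measurableSingletonClass : MeasurableSingletonClass (SimpleGraph V) where
  measurableSet_singleton G := by
    convert measurable_edgeSet (measurableSet_singleton G.edgeSet) using 1
    ext H
    simp

theorem binomialRandom_real_singleton (G : SimpleGraph V) :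
    (binomialRandom V p).real {G} = (p : ℝ) ^ G.edgeSet.ncard *
      (1 - (p : ℝ)) ^ ((Fintype.card V).choose 2 - G.edgeSet.ncard) := by
  rw [measureReal_def, binomialRandom_singleton]
  simp

-- Expanding a product over all non-diagonal pairs gives one term per graph. At x = 0 this is the
-- probability that A contains no edge.
open scoped Classical in
theorem sum_binomialRandom_mul_pow (A : Finset (Sym2 V)) (hA : ∀ e ∈ A, ¬ e.IsDiag) (x : ℝ) :
    ∑ G : SimpleGraph V, (binomialRandom V p).real {G} * x ^ (G.edgeFinset ∩ A).card =
      (1 - p + p * x) ^ A.card := by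
  set N : Finset (Sym2 V) := univ.filter fun e => ¬ e.IsDiag with hN
  have hAN : A ⊆ N := fun e he => by simpa [hN] using hA e he
  have hNcard : N.card = (Fintype.card V).choose 2 := by
    rw [hN, ← Sym2.card_subtype_not_diag, Fintype.card_subtype]
  have h1 : (1 - (p : ℝ) + p * x) ^ A.card =
      ∏ e ∈ N, ((p : ℝ) * (if e ∈ A then x else 1) + (1 - p)) := by
    rw [← Finset.prod_subset hAN]
    · rw [← Finset.prod_const]
      refine Finset.prod_congr rfl fun e he => ?_
      rw [if_pos he]; ring
    · intro e _ he
      rw [if_neg he]; ring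
  rw [h1, Finset.prod_add]
  refine Finset.sum_bij' (fun G _ => G.edgeFinset) (fun B _ => fromEdgeSet (B : Set (Sym2 V)))
    ?_ ?_ ?_ ?_ ?_
  · intro G _
    rw [mem_powerset]
    intro e he
    simpa [hN] using G.not_isDiag_of_mem_edgeFinset he
  · simp
  · intro G _
    simp
  · intro B hB
    rw [mem_powerset] at hB
    ext e
    have : e ∈ B → ¬ e.IsDiag := fun h => by simpa [hN] using hB h
    simpa using this
  · intro G _
    have hsub : G.edgeFinset ⊆ N := fun e he => by
      simpa [hN] using G.not_isDiag_of_mem_edgeFinset he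
    rw [binomialRandom_real_singleton, ← coe_edgeFinset, Set.ncard_coe_finset, prod_const,
      card_sdiff_of_subset hsub, hNcard, prod_mul_distrib, prod_const, Finset.prod_ite]
    simp only [prod_const, one_pow, mul_one, filter_mem_eq_inter]
    ring

open scoped Classical in
theorem sum_binomialRandom : ∑ G : SimpleGraph V, (binomialRandom V p).real {G} = 1 := by
  simp

open scoped Classical in
/-- Markov's inequality. -/
theorem binomialRandom_real_le_sum (P : Set (SimpleGraph V)) (h : SimpleGraph V → ℝ)
    (h0 : ∀ G, 0 ≤ h G) (h1 : ∀ G ∈ P, 1 ≤ h G) :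
    (binomialRandom V p).real P ≤ ∑ G : SimpleGraph V, (binomialRandom V p).real {G} * h G := by
  have : (binomialRandom V p).real P =
      ∑ G ∈ univ.filter (· ∈ P), (binomialRandom V p).real {G} := by
    rw [sum_measureReal_singleton]; simp
  rw [this, Finset.sum_filter]
  refine Finset.sum_le_sum fun G _ => ?_
  split_ifs with hG
  · exact le_mul_of_one_le_right measureReal_nonneg (h1 G hG)
  · exact mul_nonneg measureReal_nonneg (h0 G)

open scoped Classical in
/-- Chernoff bound for the number of edges in a set of pairs, with parameter `c` in place of
the exponential. -/
theorem binomialRandom_real_chernoff (A : Finset (Sym2 V)) (hA : ∀ e ∈ A, ¬ e.IsDiag) {c : ℝ}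
    (hc : 0 < c) (a : ℝ) :
    (binomialRandom V p).real
      {G | 0 ≤ Real.log c * ((G.edgeFinset ∩ A).card - a)} ≤
      Real.exp (- (Real.log c * a) + p * A.card * (c - 1)) := by
  -- The sign of log c selects the tail: lower for c < 1, upper for c > 1.
  have h := binomialRandom_real_le_sum p {G | 0 ≤ Real.log c * ((G.edgeFinset ∩ A).card - a)}
    (fun G => Real.exp (- (Real.log c * a)) * c ^ (G.edgeFinset ∩ A).card)
    (fun G => by positivity) (fun G hG => by
      rw [← Real.exp_log (pow_pos hc _), Real.log_pow, ← Real.exp_add, Real.one_le_exp_iff]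
      have : 0 ≤ Real.log c * ((G.edgeFinset ∩ A).card - a) := hG
      linarith)
  refine h.trans ?_
  simp only [mul_left_comm _ (Real.exp _)]
  rw [← Finset.mul_sum, sum_binomialRandom_mul_pow p A hA, Real.exp_add]
  gcongr
  rw [show (p : ℝ) * A.card * (c - 1) = A.card * (p * (c - 1)) by ring, Real.exp_nat_mul]
  have hp0 := p.2.1
  have hp1 := p.2.2
  have h2 := Real.add_one_le_exp ((p : ℝ) * (c - 1))
  exact pow_le_pow_left₀ (by nlinarith [mul_nonneg hp0 hc.le]) (by linarith) _

end Random

end SimpleGraph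

namespace SimpleGraph

open MeasureTheory Finset

/-! ### The dense range. -/

section Dense

variable {V : Type*} [Fintype V]

open scoped Classical in
theorem card_mul_le_card_pairSet {S T : Finset V} (h : Disjoint S T) (hTS : T.card < S.card) :
    (S.card : ℝ) * (Fintype.card V - 1) / 4 ≤ (pairSet S T).card := by
  rw [card_pairSet S T h]
  have h1 : S.card + T.card ≤ Fintype.card V := by
    rw [← card_union_of_disjoint h]; exact card_le_univ _
  have h1' : (S.card : ℝ) + T.card ≤ Fintype.card V := by exact_mod_cast h1
  have h2 : (T.card : ℝ) + 1 ≤ S.card := by exact_mod_cast hTS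
  have h3 : (0 : ℝ) ≤ T.card := by positivity
  -- As |S| + |T| ≤ n, the bracket is at least |S| - |T| - 1.
  have : 0 ≤ (S.card : ℝ) * (3 * Fintype.card V - 4 * T.card - 2 * S.card - 1) :=
    mul_nonneg (by linarith) (by linarith)
  nlinarith

open scoped Classical in
theorem two_mul_sub_le_card_pairSet {S T : Finset V} (h : Disjoint S T) (hTS : T.card < S.card)
    (hS : 2 ≤ S.card) :
    2 * (Fintype.card V : ℝ) - 36 ≤ (pairSet S T).card := by
  have hS' : (2 : ℝ) ≤ S.card := by exact_mod_cast hS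
  have h2 : (T.card : ℝ) + 1 ≤ S.card := by exact_mod_cast hTS
  have hn : (S.card : ℝ) ≤ Fintype.card V := by exact_mod_cast card_le_univ _
  rcases le_total 12 S.card with h12 | h12
  · have := card_mul_le_card_pairSet h hTS
    have h12' : (12 : ℝ) ≤ S.card := by exact_mod_cast h12
    nlinarith
  · have h12' : (S.card : ℝ) ≤ 12 := by exact_mod_cast h12
    rw [card_pairSet S T h]
    rcases le_total (Fintype.card V : ℝ) 18 with h18 | h18
    · have hnn : (0 : ℝ) ≤ (pairSet S T).card := Nat.cast_nonneg _
      rw [card_pairSet S T h] at hnn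
      linarith
    · have : (2 : ℝ) * (Fintype.card V - 18) ≤ S.card * (Fintype.card V - 18) := by
        gcongr
      have : (S.card : ℝ) * (Fintype.card V - 18) ≤
          S.card * ((2 * (Fintype.card V - T.card) - S.card - 1) / 2) := by
        gcongr; linarith
      linarith

open scoped Classical in
theorem binomialRandom_real_pairSet_lt_le {p : unitInterval} (hn : 1000 ≤ Fintype.card V)
    (hp : 500 * Real.log (Fintype.card V) ≤ Fintype.card V * p) {S T : Finset V}
    (h : Disjoint S T) (hTS : T.card < S.card) (hS : 2 ≤ S.card) :
    (binomialRandom V p).real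
      {G | ((G.edgeFinset ∩ pairSet S T).card : ℝ) ≤ 5 / 4 * (Fintype.card V * p)} ≤
      ((Fintype.card V : ℝ)⁻¹ ^ 2) ^ S.card * ((Fintype.card V : ℝ)⁻¹ ^ 2) ^ T.card *
        (Fintype.card V : ℝ)⁻¹ := by
  set n : ℝ := (Fintype.card V : ℝ) with hndef
  have hn' : (1000 : ℝ) ≤ n := by rw [hndef]; exact_mod_cast hn
  have hn0 : 0 < n := by linarith
  have hlog : 0 ≤ Real.log n := Real.log_nonneg (by linarith)
  have hl2 : Real.log (1 / 2) = - Real.log 2 := by simp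
  have hl2p : 0 < Real.log 2 := Real.log_pos (by norm_num)
  have hset : {G : SimpleGraph V |
      ((G.edgeFinset ∩ pairSet S T).card : ℝ) ≤ 5 / 4 * (n * p)} ⊆
      {G | 0 ≤ Real.log (1 / 2) * ((G.edgeFinset ∩ pairSet S T).card - 5 / 4 * (n * p))} := by
    intro G hG
    have : ((G.edgeFinset ∩ pairSet S T).card : ℝ) ≤ 5 / 4 * (n * p) := hG
    show 0 ≤ Real.log (1 / 2) * ((G.edgeFinset ∩ pairSet S T).card - 5 / 4 * (n * p))
    rw [hl2]
    nlinarith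
  refine (measureReal_mono hset).trans ((binomialRandom_real_chernoff p (pairSet S T)
    (fun e he => not_isDiag_of_mem_pairSet he) (by norm_num) _).trans ?_)
  have hM1 := card_mul_le_card_pairSet h hTS
  have hM2 := two_mul_sub_le_card_pairSet h hTS hS
  rw [← hndef] at hM1 hM2
  set M : ℝ := ((pairSet S T).card : ℝ)
  have hp0 : (0 : ℝ) ≤ p := p.2.1
  have hTS' : (T.card : ℝ) + 1 ≤ S.card := by exact_mod_cast hTS
  have hs0 : (2 : ℝ) ≤ S.card := by exact_mod_cast hS
  have hrhs : (n⁻¹ ^ 2) ^ S.card * (n⁻¹ ^ 2) ^ T.card * n⁻¹ =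
      Real.exp (- (2 * S.card + 2 * T.card + 1) * Real.log n) := by
    have : n⁻¹ = Real.exp (- Real.log n) := by rw [Real.exp_neg, Real.exp_log hn0]
    rw [this, ← Real.exp_nat_mul, ← Real.exp_nat_mul, ← Real.exp_nat_mul, ← Real.exp_add,
      ← Real.exp_add]
    congr 1
    push_cast
    ring
  rw [hrhs, Real.exp_le_exp, hl2]
  have hL : 0 ≤ n * (p : ℝ) := by positivity
  -- Of the available pM/2, a share 0.867/1.96 < 0.443 of pM absorbs the threshold term; the rest is
  -- at least 0.057·0.24·500 > 6 times |S| log n.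
  have h1 : Real.log 2 * (5 / 4 * (n * p)) ≤ 0.867 * (n * p) := by
    have := Real.log_two_lt_d9
    nlinarith
  have h2 : 1.96 * (n * p) ≤ p * M := by nlinarith
  have h3 : 0.24 * (S.card * (n * p)) ≤ p * M := by
    have : 0.24 * (S.card * n) ≤ M := by nlinarith
    nlinarith
  have h4 : S.card * (500 * Real.log n) ≤ S.card * (n * p) := by gcongr
  have h5 : (2 * S.card + 2 * T.card + 1) * Real.log n ≤ (6 * S.card) * Real.log n := by
    gcongr; linarith
  nlinarith

-- Only one fixed vertex is needed, so no union bound over vertices is paid.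
open scoped Classical in
theorem binomialRandom_real_le_degree_le {p : unitInterval} (hn : 1000 ≤ Fintype.card V)
    (hp : 500 * Real.log (Fintype.card V) ≤ Fintype.card V * p) (v : V) :
    (binomialRandom V p).real {G | 5 / 4 * ((Fintype.card V : ℝ) * p) ≤ G.degree v} ≤
      (Fintype.card V : ℝ)⁻¹ := by
  set n : ℝ := (Fintype.card V : ℝ) with hndef
  have hn' : (1000 : ℝ) ≤ n := by rw [hndef]; exact_mod_cast hn
  have hn0 : 0 < n := by linarith
  have hp0 : (0 : ℝ) ≤ p := p.2.1
  have hlog : 0.22 ≤ Real.log (5 / 4) := by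
    rw [Real.le_log_iff_exp_le (by norm_num)]
    have h50 : Real.exp 0.22 ^ 50 ≤ (5 / 4) ^ 50 := by
      rw [← Real.exp_nat_mul]
      have : ((50 : ℕ) : ℝ) * 0.22 = ((11 : ℕ) : ℝ) * 1 := by norm_num
      rw [this, Real.exp_nat_mul]
      calc Real.exp 1 ^ 11 ≤ 2.72 ^ 11 := by
            gcongr
            linarith [Real.exp_one_lt_d9]
        _ ≤ _ := by norm_num
    exact le_of_pow_le_pow_left₀ (by norm_num) (by norm_num) h50
  have hset : {G : SimpleGraph V | 5 / 4 * (n * p) ≤ G.degree v} ⊆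
      {G | 0 ≤ Real.log (5 / 4) *
        ((G.edgeFinset ∩ pairSet {v} ∅).card - 5 / 4 * (n * p))} := by
    intro G hG
    have : 5 / 4 * (n * p) ≤ G.degree v := hG
    show 0 ≤ Real.log (5 / 4) * ((G.edgeFinset ∩ pairSet {v} ∅).card - 5 / 4 * (n * p))
    rw [card_edgeFinset_inter_pairSet_singleton]
    exact mul_nonneg (by linarith) (by linarith)
  refine (measureReal_mono hset).trans ((binomialRandom_real_chernoff p (pairSet {v} ∅)
    (fun e he => not_isDiag_of_mem_pairSet he) (by norm_num) _).trans ?_)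
  have hinv : n⁻¹ = Real.exp (- Real.log n) := by rw [Real.exp_neg, Real.exp_log hn0]
  rw [card_pairSet _ _ (disjoint_empty_right _), hinv, Real.exp_le_exp, ← hndef]
  simp only [card_singleton, card_empty, Nat.cast_one, Nat.cast_zero]
  have hL : 0 ≤ n * (p : ℝ) := by positivity
  have hlogn : 0 ≤ Real.log n := Real.log_nonneg (by linarith)
  -- 0.22·5/4 = 0.275 exceeds c - 1 = 1/4, leaving 0.025·np ≥ log n.
  have : 0.22 * (5 / 4 * (n * p)) ≤ Real.log (5 / 4) * (5 / 4 * (n * p)) := by gcongr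
  nlinarith

/-- A random graph whose density exceeds a suitable multiple of `log n / n` fails to have the
Manickam-Miklós-Singhi property with probability at most `9 / n`. -/
theorem binomialRandom_real_not_hasMMSProperty_le {p : unitInterval}
    (hn : 1000 ≤ Fintype.card V)
    (hp : 500 * Real.log (Fintype.card V) ≤ Fintype.card V * p) :
    (binomialRandom V p).real {G | ¬ G.HasMMSProperty} ≤ 9 * (Fintype.card V : ℝ)⁻¹ := by
  classical
  have hne : Nonempty V := Fintype.card_pos_iff.1 (by omega)
  obtain ⟨v⟩ := id hne
  set n : ℝ := (Fintype.card V : ℝ) with hndef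
  have hn' : (1000 : ℝ) ≤ n := by rw [hndef]; exact_mod_cast hn
  have hn0 : 0 < n := by linarith
  let Q : Finset (Finset V × Finset V) :=
    univ.filter fun q => Disjoint q.1 q.2 ∧ q.2.card < q.1.card ∧ 2 ≤ q.1.card
  let B : Finset V × Finset V → Set (SimpleGraph V) := fun q =>
    {G | ((G.edgeFinset ∩ pairSet q.1 q.2).card : ℝ) ≤ 5 / 4 * (n * p)}
  have hset : {G : SimpleGraph V | ¬ G.HasMMSProperty} ⊆
      {G | 5 / 4 * (n * p) ≤ G.degree v} ∪ ⋃ q ∈ Q, B q := by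
    intro G hG
    by_contra hcon
    simp only [Set.mem_union, Set.mem_iUnion, not_or, not_exists] at hcon
    obtain ⟨hdeg, hB⟩ := hcon
    have hdeg' : (G.degree v : ℝ) < 5 / 4 * (n * p) := not_le.1 hdeg
    refine hG (hasMMSProperty_of_card_pairSet G fun S T hd hTS => ?_)
    rcases le_or_gt 2 S.card with h2 | h2
    · have h3 : ¬ ((G.edgeFinset ∩ pairSet S T).card : ℝ) ≤ 5 / 4 * (n * p) :=
        hB (S, T) (by simp only [Q, mem_filter, mem_univ, true_and]; exact ⟨hd, hTS, h2⟩)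
      have h4 : (G.degree v : ℝ) ≤ (G.edgeFinset ∩ pairSet S T).card := by linarith
      exact (G.minDegree_le_degree v).trans (by exact_mod_cast h4)
    · obtain ⟨w, rfl⟩ := card_eq_one.1 (show S.card = 1 by omega)
      obtain rfl : T = ∅ := card_eq_zero.1 (by simpa using hTS)
      rw [card_edgeFinset_inter_pairSet_singleton]
      exact G.minDegree_le_degree w
  -- The tail bound factors over S and T, so the union bound is a product of two binomial
  -- expansions.
  have hsumS : ∑ S : Finset V, (n⁻¹ ^ 2) ^ S.card ≤ Real.exp 1 := by
    have h1 : ∑ S : Finset V, (n⁻¹ ^ 2) ^ S.card = (n⁻¹ ^ 2 + 1) ^ Fintype.card V := by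
      rw [← Fintype.sum_pow_mul_eq_add_pow V (n⁻¹ ^ 2) 1]
      simp
    rw [h1]
    calc (n⁻¹ ^ 2 + 1) ^ Fintype.card V ≤ Real.exp (n⁻¹ ^ 2) ^ Fintype.card V := by
          gcongr
          exact Real.add_one_le_exp _
      _ = Real.exp n⁻¹ := by
          rw [← Real.exp_nat_mul, ← hndef]
          congr 1
          field_simp
      _ ≤ Real.exp 1 := by
          rw [Real.exp_le_exp]
          exact inv_le_one_of_one_le₀ (by linarith)
  have hsum0 : 0 ≤ ∑ S : Finset V, (n⁻¹ ^ 2) ^ S.card := by positivity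
  have he : Real.exp 1 * Real.exp 1 ≤ 8 := by
    nlinarith [Real.exp_one_lt_d9, Real.exp_pos 1]
  calc (binomialRandom V p).real {G | ¬ G.HasMMSProperty}
      ≤ (binomialRandom V p).real {G | 5 / 4 * (n * p) ≤ G.degree v} +
          (binomialRandom V p).real (⋃ q ∈ Q, B q) :=
        (measureReal_mono hset).trans (measureReal_union_le _ _)
    _ ≤ n⁻¹ + ∑ q ∈ Q, (binomialRandom V p).real (B q) := by
        gcongr
        · exact binomialRandom_real_le_degree_le hn hp v
        · exact measureReal_biUnion_finset_le _ _
    _ ≤ n⁻¹ + ∑ q ∈ Q, (n⁻¹ ^ 2) ^ q.1.card * (n⁻¹ ^ 2) ^ q.2.card * n⁻¹ := by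
        gcongr with q hq
        obtain ⟨hd, hTS, h2⟩ := (mem_filter.1 hq).2
        exact binomialRandom_real_pairSet_lt_le hn hp hd hTS h2
    _ ≤ n⁻¹ + ∑ q : Finset V × Finset V, (n⁻¹ ^ 2) ^ q.1.card * (n⁻¹ ^ 2) ^ q.2.card * n⁻¹ := by
        gcongr
        exact subset_univ _
    _ = n⁻¹ + (∑ S : Finset V, (n⁻¹ ^ 2) ^ S.card) * (∑ S : Finset V, (n⁻¹ ^ 2) ^ S.card) *
          n⁻¹ := by
        rw [← Finset.sum_mul, Fintype.sum_prod_type, Finset.sum_mul_sum]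
    _ ≤ n⁻¹ + Real.exp 1 * Real.exp 1 * n⁻¹ := by gcongr
    _ ≤ n⁻¹ + 8 * n⁻¹ := by gcongr
    _ = 9 * n⁻¹ := by ring

end Dense

/-! ### The sparse range: isolated vertices. -/

section Sparse

variable {V : Type*} [Fintype V]

open scoped Classical in
theorem mem_pairSet_pair_iff {u v : V} {e : Sym2 V} :
    e ∈ pairSet {u, v} ∅ ↔ e ∈ pairSet {u} ∅ ∨ e ∈ pairSet {v} ∅ := by
  induction e with
  | h a b =>
    simp only [mk_mem_pairSet, Finset.mem_insert, Finset.mem_singleton, Finset.notMem_empty]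
    grind

open scoped Classical in
theorem card_pairSet_singleton (v : V) :
    (pairSet {v} ∅).card = Fintype.card V - 1 := by
  have h1 : 1 ≤ Fintype.card V := Fintype.card_pos_iff.2 ⟨v⟩
  have h := card_pairSet {v} (∅ : Finset V) (disjoint_empty_right _)
  rw [← Nat.cast_inj (R := ℝ), h, Nat.cast_sub h1]
  simp
  ring

open scoped Classical in
theorem card_pairSet_pair {u v : V} (huv : u ≠ v) :
    (pairSet {u, v} ∅).card + 1 = 2 * (Fintype.card V - 1) := by
  have h1 : 1 ≤ Fintype.card V := Fintype.card_pos_iff.2 ⟨v⟩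
  have h := card_pairSet {u, v} (∅ : Finset V) (disjoint_empty_right _)
  rw [← Nat.cast_inj (R := ℝ), Nat.cast_add, h, Nat.cast_mul, Nat.cast_sub h1, card_pair huv]
  simp
  ring

open scoped Classical in
/-- Second moment bound for the event that there is no isolated vertex. -/
theorem binomialRandom_real_minDegree_ne_zero_le {p : unitInterval} [Nonempty V]
    (hp : (p : ℝ) < 1) :
    (binomialRandom V p).real {G | G.minDegree ≠ 0} ≤
      ((Fintype.card V : ℝ) * (1 - p) ^ (Fintype.card V - 1))⁻¹ + p / (1 - p) := by
  set n : ℝ := (Fintype.card V : ℝ) with hndef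
  have hn0 : 0 < n := by rw [hndef]; exact_mod_cast Fintype.card_pos
  set q : ℝ := (1 - p) ^ (Fintype.card V - 1) with hq
  have hp1 : (0 : ℝ) < 1 - p := by linarith
  have hq0 : 0 < q := by positivity
  -- Since 0 ^ 0 = 1, this is the indicator that v is isolated.
  let X : V → SimpleGraph V → ℝ := fun v G => 0 ^ (G.edgeFinset ∩ pairSet {v} ∅).card
  have hX1 : ∀ v, ∑ G, (binomialRandom V p).real {G} * X v G = q := by
    intro v
    have := sum_binomialRandom_mul_pow p (pairSet {v} ∅)
      (fun e he => not_isDiag_of_mem_pairSet he) 0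
    rw [this, card_pairSet_singleton, mul_zero, add_zero]
  have hXX : ∀ v G, X v G * X v G = X v G := by
    intro v G
    simp only [X, zero_pow_eq]
    split_ifs <;> simp
  -- The pair uv is shared by both stars, hence the division by 1 - p.
  have hX2 : ∀ u v, u ≠ v → ∑ G, (binomialRandom V p).real {G} * (X u G * X v G) =
      q ^ 2 / (1 - p) := by
    intro u v huv
    have h := sum_binomialRandom_mul_pow p (pairSet {u, v} ∅)
      (fun e he => not_isDiag_of_mem_pairSet he) 0
    rw [mul_zero, add_zero] at h
    rw [eq_div_iff hp1.ne', hq, ← pow_mul, mul_comm _ 2, ← card_pairSet_pair huv, pow_succ, ← h]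
    congr 1
    refine Finset.sum_congr rfl fun G _ => ?_
    congr 1
    simp only [X, zero_pow_eq, card_eq_zero, Finset.eq_empty_iff_forall_notMem, mem_inter,
      mem_pairSet_pair_iff]
    by_cases hu : ∀ e, ¬ (e ∈ G.edgeFinset ∧ e ∈ pairSet {u} ∅) <;>
    by_cases hv : ∀ e, ¬ (e ∈ G.edgeFinset ∧ e ∈ pairSet {v} ∅) <;>
    simp only [hu, hv] <;> grind
  have hmarkov := binomialRandom_real_le_sum p {G | G.minDegree ≠ 0}
    (fun G => (∑ v, X v G - n * q) ^ 2 / (n * q) ^ 2) (fun G => by positivity) (by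
      intro G hG
      have : ∀ v, X v G = 0 := by
        intro v
        simp only [X]
        rw [card_edgeFinset_inter_pairSet_singleton]
        have := G.minDegree_le_degree v
        exact zero_pow (by have : G.minDegree ≠ 0 := hG; omega)
      simp only [this, Finset.sum_const_zero, zero_sub, neg_sq]
      rw [div_self (by positivity)])
  refine hmarkov.trans ?_
  have hexp : ∀ G, (∑ v, X v G - n * q) ^ 2 / (n * q) ^ 2 =
      ((n * q) ^ 2)⁻¹ * (∑ u, ∑ v, X u G * X v G) - 2 * (n * q)⁻¹ * (∑ v, X v G) + 1 := by
    intro G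
    rw [← Finset.sum_mul_sum]
    field_simp
    ring
  have hE1 : ∑ G, (binomialRandom V p).real {G} * ∑ v, X v G = n * q := by
    simp only [Finset.mul_sum]
    rw [Finset.sum_comm]
    simp [hX1, hndef]
  have hE2 : ∑ G, (binomialRandom V p).real {G} * ∑ u, ∑ v, X u G * X v G =
      n * q + n * (n - 1) * (q ^ 2 / (1 - p)) := by
    simp only [Finset.mul_sum]
    rw [Finset.sum_comm]
    have : ∀ u, ∑ G, ∑ v, (binomialRandom V p).real {G} * (X u G * X v G) =
        q + (n - 1) * (q ^ 2 / (1 - p)) := by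
      intro u
      rw [Finset.sum_comm, ← Finset.add_sum_erase _ _ (mem_univ u)]
      congr 1
      · simp only [hXX, hX1]
      · rw [Finset.sum_congr rfl fun v hv => hX2 u v (Finset.ne_of_mem_erase hv).symm,
          Finset.sum_const, card_erase_of_mem (mem_univ _), card_univ, nsmul_eq_mul,
          Nat.cast_sub Fintype.card_pos, hndef, Nat.cast_one]
    simp only [this, Finset.sum_const, card_univ, nsmul_eq_mul, ← hndef]
    ring
  have htotal : ∑ G, (binomialRandom V p).real {G} *
      ((∑ v, X v G - n * q) ^ 2 / (n * q) ^ 2) =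
      ((n * q) ^ 2)⁻¹ * (n * q + n * (n - 1) * (q ^ 2 / (1 - p))) -
        2 * (n * q)⁻¹ * (n * q) + 1 := by
    have hone := sum_binomialRandom (V := V) p
    calc
      _ = ((n * q) ^ 2)⁻¹ * (∑ G, (binomialRandom V p).real {G} * ∑ u, ∑ v, X u G * X v G) -
          2 * (n * q)⁻¹ * (∑ G, (binomialRandom V p).real {G} * ∑ v, X v G) +
          ∑ G, (binomialRandom V p).real {G} := by
        rw [Finset.mul_sum, Finset.mul_sum, ← Finset.sum_sub_distrib, ← Finset.sum_add_distrib]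
        refine Finset.sum_congr rfl fun G _ => ?_
        rw [hexp]
        ring
      _ = _ := by rw [hE1, hE2, hone]
  rw [htotal]
  have hfinal : ((n * q) ^ 2)⁻¹ * (n * q + n * (n - 1) * (q ^ 2 / (1 - p))) -
        2 * (n * q)⁻¹ * (n * q) + 1 =
      (n * q)⁻¹ + p / (1 - p) - n⁻¹ * (1 - (p : ℝ))⁻¹ := by
    have := hp1.ne'
    field_simp
    ring
  rw [hfinal]
  have : 0 ≤ n⁻¹ * (1 - (p : ℝ))⁻¹ := by positivity
  linarith

open scoped Classical in
theorem hasMMSProperty_of_minDegree_eq_zero (G : SimpleGraph V)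
    (h : G.minDegree = 0) : G.HasMMSProperty := by
  intro f _
  rw [h]
  exact Nat.zero_le _

end Sparse

end SimpleGraph

/-! ### Passage to the limit. -/

namespace SimpleGraph

open MeasureTheory

theorem tendsto_real_not_hasMMSProperty_of_isLittleO {p : ℕ → unitInterval}
    (hp : (fun n : ℕ => Real.log (n : ℝ) / (n : ℝ)) =o[atTop] (fun n : ℕ => (p n : ℝ))) :
    Tendsto (fun n : ℕ => (binomialRandom (Fin n) (p n)).real {G | ¬ G.HasMMSProperty})
      atTop (𝓝 0) := by
  have hlim : Tendsto (fun n : ℕ => 9 * (n : ℝ)⁻¹) atTop (𝓝 0) := by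
    simpa using (tendsto_inv_atTop_nhds_zero_nat (𝕜 := ℝ)).const_mul 9
  refine squeeze_zero' (Eventually.of_forall fun _ => measureReal_nonneg) ?_ hlim
  filter_upwards [hp.bound (show (0 : ℝ) < 1 / 500 by norm_num), eventually_ge_atTop 1000]
    with n hb hn
  have hn' : (1000 : ℝ) ≤ n := by exact_mod_cast hn
  have hn0 : (0 : ℝ) < n := by linarith
  have hlog : 0 ≤ Real.log n := Real.log_nonneg (by linarith)
  rw [Real.norm_of_nonneg (by positivity), Real.norm_of_nonneg (p n).2.1, div_le_iff₀ hn0] at hb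
  simpa using binomialRandom_real_not_hasMMSProperty_le (V := Fin n) (p := p n) (by simpa using hn)
    (by simp only [Fintype.card_fin]; linarith)

/-- The right side is the expected number of isolated vertices. Use 1 - p ≥ exp(-p/(1 - p)) and 1 -
ε ≤ (1 - ε/2)(1 - p). -/
theorem rpow_le_mul_one_sub_pow {ε p : ℝ} {n : ℕ} (hn : 2 ≤ n) (hp0 : 0 ≤ p)
    (hε : ε ≤ 1) (hpε : p ≤ ε / 2) (hp : p < (1 - ε) * Real.log n / n) :
    (n : ℝ) ^ (ε / 2) ≤ n * (1 - p) ^ (n - 1) := by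
  have hn0 : (0 : ℝ) < n := by positivity
  have hp1 : 0 < 1 - p := by linarith
  have hlog : 0 ≤ Real.log n := Real.log_natCast_nonneg n
  have h1 : Real.exp (-(p / (1 - p))) ≤ 1 - p := by
    rw [← Real.le_log_iff_exp_le hp1]
    have := Real.one_sub_inv_le_log_of_pos hp1
    have h2 : 1 - (1 - p)⁻¹ = -(p / (1 - p)) := by
      have := hp1.ne'
      field_simp
      ring
    linarith
  calc (n : ℝ) ^ (ε / 2) = n * Real.exp (- (1 - ε / 2) * Real.log n) := by
        conv_rhs => rw [← Real.exp_log hn0, ← Real.exp_add, Real.log_exp]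
        rw [Real.rpow_def_of_pos hn0]
        congr 1
        ring
    _ ≤ n * Real.exp (-(p / (1 - p))) ^ n := by
        gcongr
        rw [← Real.exp_nat_mul, Real.exp_le_exp]
        have h3 : n * (p / (1 - p)) ≤ (1 - ε / 2) * Real.log n := by
          rw [← mul_div_assoc, div_le_iff₀ hp1]
          rw [lt_div_iff₀ hn0] at hp
          have : 1 - ε ≤ (1 - ε / 2) * (1 - p) := by nlinarith
          nlinarith
        linarith
    _ ≤ n * (1 - p) ^ n := by gcongr
    _ ≤ n * (1 - p) ^ (n - 1) := by
        gcongr ?_ * ?_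
        exact pow_le_pow_of_le_one hp1.le (by linarith) (Nat.sub_le _ _)

theorem tendsto_real_not_hasMMSProperty_of_lt {ε : ℝ} (hε : 0 < ε) {p : ℕ → unitInterval}
    (hp : ∀ᶠ n : ℕ in atTop, (p n : ℝ) < (1 - ε) * Real.log (n : ℝ) / (n : ℝ)) :
    Tendsto (fun n : ℕ => (binomialRandom (Fin n) (p n)).real {G | ¬ G.HasMMSProperty})
      atTop (𝓝 0) := by
  classical
  -- Lowering ε to 1 only weakens the hypothesis on p.
  wlog hε1 : ε ≤ 1 generalizing ε
  · refine this one_pos ?_ le_rfl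
    filter_upwards [hp] with n hn
    refine hn.trans_le ?_
    gcongr
    exact (not_le.1 hε1).le
  have hlogn : Tendsto (fun n : ℕ => Real.log n / n) atTop (𝓝 0) :=
    (Real.isLittleO_log_id_atTop.comp_tendsto tendsto_natCast_atTop_atTop).tendsto_div_nhds_zero
  have hp0 : Tendsto (fun n => (p n : ℝ)) atTop (𝓝 0) := by
    refine squeeze_zero' (Eventually.of_forall fun n => (p n).2.1) ?_
      (by simpa using hlogn.const_mul (1 - ε))
    filter_upwards [hp] with n hn
    rw [← mul_div_assoc]
    exact hn.le
  have hlim : Tendsto (fun n : ℕ => ((n : ℝ) ^ (ε / 2))⁻¹ + p n / (1 - p n)) atTop (𝓝 0) := by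
    have h1 : Tendsto (fun n : ℕ => ((n : ℝ) ^ (ε / 2))⁻¹) atTop (𝓝 0) :=
      ((tendsto_rpow_atTop (half_pos hε)).comp tendsto_natCast_atTop_atTop).inv_tendsto_atTop
    have h2 := hp0.div (hp0.const_sub 1) (by norm_num)
    simpa using h1.add h2
  refine squeeze_zero' (Eventually.of_forall fun _ => measureReal_nonneg) ?_ hlim
  filter_upwards [hp, eventually_ge_atTop 2, hp0.eventually_le_const (half_pos hε)] with n hn h2 hpε
  have : Nonempty (Fin n) := ⟨⟨0, by omega⟩⟩
  have hsub : {G : SimpleGraph (Fin n) | ¬ G.HasMMSProperty} ⊆ {G | G.minDegree ≠ 0} :=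
    fun G hG h0 => hG (hasMMSProperty_of_minDegree_eq_zero G (by convert h0))
  refine (measureReal_mono hsub).trans ?_
  have hb := binomialRandom_real_minDegree_ne_zero_le (V := Fin n) (p := p n) (by linarith)
  have hpow := rpow_le_mul_one_sub_pow h2 (p n).2.1 hε1 hpε hn
  rw [Fintype.card_fin] at hb
  have hpos : 0 < (n : ℝ) ^ (ε / 2) := by positivity
  calc _ ≤ ((n : ℝ) * (1 - p n) ^ (n - 1))⁻¹ + p n / (1 - p n) := by convert hb
    _ ≤ _ := by gcongr

end SimpleGraph

theorem mainTheorem2 (ε : ℝ) (hε : 0 < ε) (p : ℕ → unitInterval)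
    (hp : (fun n : ℕ => Real.log (n : ℝ) / (n : ℝ)) =o[atTop] (fun n : ℕ => (p n : ℝ)) ∨
      ∀ᶠ n : ℕ in atTop, (p n : ℝ) < (1 - ε) * Real.log (n : ℝ) / (n : ℝ)) :
    Tendsto
      (fun n : ℕ => SimpleGraph.binomialRandom (Fin n) (p n)
        {G : SimpleGraph (Fin n) | G.HasMMSProperty})
      atTop (𝓝 1) := by
  have h : Tendsto (fun n : ℕ => (SimpleGraph.binomialRandom (Fin n) (p n)).real
      {G | ¬ G.HasMMSProperty}) atTop (𝓝 0) :=
    hp.elim SimpleGraph.tendsto_real_not_hasMMSProperty_of_isLittleO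
      (SimpleGraph.tendsto_real_not_hasMMSProperty_of_lt hε)
  have h1 := ENNReal.tendsto_ofReal (h.const_sub 1)
  simp only [sub_zero, ENNReal.ofReal_one] at h1
  refine h1.congr fun n => ?_
  have hm : MeasurableSet {G : SimpleGraph (Fin n) | G.HasMMSProperty} := Set.Finite.measurableSet
    (Set.toFinite _)
  have hc := MeasureTheory.probReal_compl_eq_one_sub
    (μ := SimpleGraph.binomialRandom (Fin n) (p n)) hm
  have : {G : SimpleGraph (Fin n) | ¬ G.HasMMSProperty} = {G | G.HasMMSProperty}ᶜ := rfl
  rw [this, hc, sub_sub_cancel, MeasureTheory.ofReal_measureReal]
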